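/- Let $n\ge 0$. On the polynomial ring $\mathbb C[z,\bar z]$ in $2n$ independent variables $z=(z_1,\dots,z_n)$, $\bar z=(\bar z_1,\dots,\bar z_n)$ let $*$ be the involution that conjugates coefficients and exchanges $z_j$ and $\bar z_j$; its fixed ring is the real polynomial ring $\mathbb R[x,y]$ in the $2n$ variables $x_j=\frac12(z_j+\bar z_j)$, $y_j=\frac1{2i}(z_j-\bar z_j)$. For $f\in\mathbb R[x,y]$ and $a\in\mathbb C^n$ write $f(a)\in\mathbb R$ for the value of $f$ at $z=a$, $\bar z=\bar a$. Let $\Sigma_h\subset\mathbb R[x,y]$ be the semiring of hermitian sums of squares, i.e. the convex cone generated by all $|p|^2=pp^*$ with $p\in\mathbb C[z]$. A hermitian module is a subset $M\subset\mathbb R[x,y]$ with $M+M\subset M$, $\Sigma_hM\subset M$ and $1\in M$; it is finitely generated if $M=\Sigma_hf_1+\dots+\Sigma_hf_r$ for some $f_1,\dots,f_r\in\mathbb R[x,y]$. Put $X_M=\{a\in\mathbb C^n: g(a)\ge0\text{ for all }g\in M\}$. An analytic disc is the image of a nonconstant holomorphic map from the open unit disc to $\mathbb C^n$. Corollary. Let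 $M$ be a finitely generated hermitian module. If $X_M$ contains an analytic disc, then $M$ does not satisfy Quillen's property (Q); that is, there exists $f\in\mathbb R[x,y]$ with $f(a)>0$ for all $a\in X_M$ and $f\notin M$. -/

import Mathlib

noncomputable section

namespace HermPoly

/-- The polynomial ring `ℂ[z, z̄]` in `2n` independent variables: `X (Sum.inl j)` is `z_j` and
`X (Sum.inr j)` is `z̄_j`. -/
abbrev CPoly (n : ℕ) : Type := MvPolynomial (Fin n ⊕ Fin n) ℂ

/-- The `ℂ/ℝ`-involution `*` of `ℂ[z, z̄]`: it conjugates the coefficients and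
exchanges `z_j` and `z̄_j`. -/
def conjStar (n : ℕ) : CPoly n →+* CPoly n :=
  (MvPolynomial.rename Sum.swap : CPoly n →ₐ[ℂ] CPoly n).toRingHom.comp
    (MvPolynomial.map (starRingEnd ℂ))

theorem conjStar_C {n : ℕ} (c : ℂ) :
    conjStar n (MvPolynomial.C c) = MvPolynomial.C (starRingEnd ℂ c) := by
  simp [conjStar]

theorem conjStar_X {n : ℕ} (s : Fin n ⊕ Fin n) :
    conjStar n (MvPolynomial.X s) = MvPolynomial.X s.swap := by
  simp [conjStar]

theorem conjStar_conjStar {n : ℕ} (f : CPoly n) : conjStar n (conjStar n f) = f := by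
  have h : (conjStar n).comp (conjStar n) = RingHom.id _ := by
    apply MvPolynomial.ringHom_ext
    · intro c; simp [conjStar_C]
    · intro s; simp [conjStar_X]
  exact congrArg (fun g : CPoly n →+* CPoly n => g f) h

/-- The real polynomial ring `ℝ[x, y]`, `x_j = (z_j + z̄_j)/2`, `y_j = (z_j - z̄_j)/(2i)`,
realized as the fixed ring of the involution on `ℂ[z, z̄]`. -/
def RealPoly (n : ℕ) : Subalgebra ℝ (CPoly n) where
  carrier := {f | conjStar n f = f}
  mul_mem' := by
    intro a b ha hb
    simp only [Set.mem_ofPred_eq] at ha hb ⊢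
    rw [map_mul, ha, hb]
  add_mem' := by
    intro a b ha hb
    simp only [Set.mem_ofPred_eq] at ha hb ⊢
    rw [map_add, ha, hb]
  algebraMap_mem' := by
    intro r
    have h : algebraMap ℝ (CPoly n) r = MvPolynomial.C (r : ℂ) := rfl
    simp only [Set.mem_ofPred_eq]
    rw [h, conjStar_C, Complex.conj_ofReal]

/-- The inclusion `ℂ[z] ⊆ ℂ[z, z̄]`. -/
def holo {n : ℕ} : MvPolynomial (Fin n) ℂ →ₐ[ℂ] CPoly n := MvPolynomial.rename Sum.inl

/-- The hermitian square `|p|² = p p*` of a holomorphic polynomial `p ∈ ℂ[z]`. -/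
def hermSq {n : ℕ} (p : MvPolynomial (Fin n) ℂ) : RealPoly n :=
  ⟨holo p * conjStar n (holo p), by
    change conjStar n _ = _
    rw [map_mul, conjStar_conjStar, mul_comm]⟩

theorem hermSq_mul {n : ℕ} (p q : MvPolynomial (Fin n) ℂ) :
    hermSq (p * q) = hermSq p * hermSq q := by
  apply Subtype.ext
  simp only [hermSq, map_mul, MulMemClass.mk_mul_mk]
  ring

theorem hermSq_one {n : ℕ} : hermSq (1 : MvPolynomial (Fin n) ℂ) = 1 := by
  apply Subtype.ext
  simp [hermSq]

/-- The convex cone in `ℝ[x, y]` generated by all hermitian squares `|p|²`, `p ∈ ℂ[z]`. -/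
def hermCone (n : ℕ) : PointedCone ℝ (RealPoly n) :=
  Submodule.span _ (Set.range hermSq)

/-- The semiring `Σ_h` of hermitian sums of squares: the convex cone generated by all
hermitian squares, which is closed under products. -/
def SigmaH (n : ℕ) : Subsemiring (RealPoly n) where
  carrier := hermCone n
  zero_mem' := (hermCone n).zero_mem
  add_mem' := (hermCone n).add_mem
  one_mem' := Submodule.subset_span ⟨1, hermSq_one⟩
  mul_mem' := by
    intro a b ha hb
    simp only [SetLike.mem_coe] at ha hb ⊢
    unfold hermCone at ha hb ⊢
    induction ha using Submodule.span_induction with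
    | zero => rw [zero_mul]; exact Submodule.zero_mem _
    | add x y _ _ hx hy => rw [add_mul]; exact Submodule.add_mem _ hx hy
    | smul c x _ hx => rw [smul_mul_assoc]; exact Submodule.smul_mem _ c hx
    | mem x hx =>
      obtain ⟨p, rfl⟩ := hx
      induction hb using Submodule.span_induction with
      | zero => rw [mul_zero]; exact Submodule.zero_mem _
      | add x y _ _ hx hy => rw [mul_add]; exact Submodule.add_mem _ hx hy
      | smul c x _ hx => rw [mul_smul_comm]; exact Submodule.smul_mem _ c hx
      | mem x hx =>
        obtain ⟨q, rfl⟩ := hx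
        exact Submodule.subset_span ⟨p * q, hermSq_mul p q⟩

/-- The complex value `f(a, ā)`. -/
def cval {n : ℕ} (a : Fin n → ℂ) (f : CPoly n) : ℂ :=
  MvPolynomial.eval (Sum.elim a (fun j => starRingEnd ℂ (a j))) f

theorem cval_conjStar {n : ℕ} (a : Fin n → ℂ) (f : CPoly n) :
    cval a (conjStar n f) = starRingEnd ℂ (cval a f) := by
  have h : (MvPolynomial.eval (Sum.elim a (fun j => starRingEnd ℂ (a j)))).comp (conjStar n)
      = (starRingEnd ℂ).comp
        (MvPolynomial.eval (Sum.elim a (fun j => starRingEnd ℂ (a j)))) := by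
    apply MvPolynomial.ringHom_ext
    · intro c; simp [conjStar_C]
    · rintro (j | j) <;> simp [conjStar_X]
  exact congrArg (fun g : CPoly n →+* ℂ => g f) h

/-- The value `f(a) = f(a, ā)` at `a ∈ ℂⁿ` of a real polynomial `f ∈ ℝ[x, y]`, a real number
(see `val_eq`). -/
def val {n : ℕ} (a : Fin n → ℂ) (f : RealPoly n) : ℝ := (cval a (f : CPoly n)).re

theorem val_eq {n : ℕ} (a : Fin n → ℂ) (f : RealPoly n) :
    ((val a f : ℝ) : ℂ) = cval a (f : CPoly n) := by
  have h := cval_conjStar a (f : CPoly n)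
  rw [show conjStar n (f : CPoly n) = f from f.2] at h
  exact Complex.conj_eq_iff_re.mp h.symm

/-- A hermitian module: a subset `M ⊆ ℝ[x, y]` with `M + M ⊆ M`, `Σ_h M ⊆ M` and `1 ∈ M`. -/
structure HermitianModule (n : ℕ) extends Submodule (SigmaH n) (RealPoly n) where
  one_mem' : (1 : RealPoly n) ∈ carrier

/-- `M = Σ_h f_1 + ⋯ + Σ_h f_r` for some `f_1, …, f_r ∈ ℝ[x, y]`. -/
def HermitianModule.FinitelyGenerated {n : ℕ} (M : HermitianModule n) : Prop :=
  M.toSubmodule.FG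

/-- The closed set `X_M = {a ∈ ℂⁿ : g(a) ≥ 0 for all g ∈ M}`. -/
def HermitianModule.posSet {n : ℕ} (M : HermitianModule n) : Set (Fin n → ℂ) :=
  {a | ∀ g ∈ M.toSubmodule, 0 ≤ val a g}

/-- Quillen's property (Q): `M` contains every `f ∈ ℝ[x, y]` with `f > 0` on `X_M`. -/
def HermitianModule.QuillenProperty {n : ℕ} (M : HermitianModule n) : Prop :=
  ∀ f : RealPoly n, (∀ a ∈ M.posSet, 0 < val a f) → f ∈ M.toSubmodule

/-- An analytic disc in `ℂⁿ`: the image of a nonconstant holomorphic map from the open unit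
disc to `ℂⁿ`. -/
def IsAnalyticDisc {n : ℕ} (D : Set (Fin n → ℂ)) : Prop :=
  ∃ φ : ℂ → Fin n → ℂ,
    DifferentiableOn ℂ φ (Metric.ball 0 1) ∧
    (∃ z ∈ Metric.ball (0 : ℂ) 1, ∃ w ∈ Metric.ball (0 : ℂ) 1, φ z ≠ φ w) ∧
    D = φ '' Metric.ball 0 1

end HermPoly

end

namespace HermPoly

open MvPolynomial Filter Topology

/-! A Levi form separates a positive polynomial from `M`. At a point `a = φ t` of the disc with `v =
φ' t ≠ 0`, take the functional L(h) = (∂_v ∂̄_v h)(a) + A h(a). On |p|² g it is a hermitian form in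
(p(a), ∂_v p(a)). If g(a) > 0, this form is positive semidefinite for large A; if g vanishes on the
disc near a, it is zero (`vanish_along`). There are finitely many generators, so some a on the disc
puts each of them in one of these cases (`exists_open_sign`), and one A serves them all: L ≥ 0 on
`M`. Yet L is negative on (N|z - a|² - 1)² + 1 for large N, although this polynomial is positive
everywhere. -/

/-- The derivation `∑ v_j ∂/∂z_j` of `ℂ[z, z̄]`. -/
noncomputable def dz {n : ℕ} (v : Fin n → ℂ) : Derivation ℂ (CPoly n) (CPoly n) :=
  mkDerivation ℂ (Sum.elim (fun j => C (v j)) (fun _ => 0))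

/-- The derivation `∑ conj v_j ∂/∂z̄_j` of `ℂ[z, z̄]`. -/
noncomputable def dzbar {n : ℕ} (v : Fin n → ℂ) : Derivation ℂ (CPoly n) (CPoly n) :=
  mkDerivation ℂ (Sum.elim (fun _ => 0) (fun j => C (starRingEnd ℂ (v j))))

/-! ### The shifted Levi form on hermitian modules. -/

section Algebra

variable {n : ℕ} (v a : Fin n → ℂ)

@[simp] theorem dz_X_inl (j : Fin n) : dz v (X (Sum.inl j)) = C (v j) := by
  simp [dz, mkDerivation_X]

@[simp] theorem dz_X_inr (j : Fin n) : dz v (X (Sum.inr j)) = 0 := by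
  simp [dz, mkDerivation_X]

@[simp] theorem dzbar_X_inl (j : Fin n) : dzbar v (X (Sum.inl j)) = 0 := by
  simp [dzbar, mkDerivation_X]

@[simp] theorem dzbar_X_inr (j : Fin n) :
    dzbar v (X (Sum.inr j)) = C (starRingEnd ℂ (v j)) := by
  simp [dzbar, mkDerivation_X]

@[simp] theorem dz_C (c : ℂ) : dz v (C c) = 0 := derivation_C _ _

@[simp] theorem dzbar_C (c : ℂ) : dzbar v (C c) = 0 := derivation_C _ _

theorem conjStar_dz (f : CPoly n) : conjStar n (dz v f) = dzbar v (conjStar n f) := by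
  induction f using MvPolynomial.induction_on with
  | C c => simp [conjStar_C]
  | add p q hp hq => simp [hp, hq]
  | mul_X p s hp =>
    rcases s with j | j <;>
      simp [hp, conjStar_X, conjStar_C, Derivation.leibniz]

theorem conjStar_dzbar (f : CPoly n) : conjStar n (dzbar v f) = dz v (conjStar n f) := by
  rw [← conjStar_conjStar (dz v (conjStar n f)), conjStar_dz, conjStar_conjStar]

theorem dzbar_holo (p : MvPolynomial (Fin n) ℂ) : dzbar v (holo p) = 0 := by
  induction p using MvPolynomial.induction_on with
  | C c => simp [holo]
  | add p q hp hq => simp [hp, hq]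
  | mul_X p j hp =>
    simp only [holo] at hp ⊢
    simp [hp, Derivation.leibniz]

theorem dz_conjStar_holo (p : MvPolynomial (Fin n) ℂ) : dz v (conjStar n (holo p)) = 0 := by
  rw [← conjStar_dzbar, dzbar_holo, map_zero]

theorem dzbar_dz_holo (p : MvPolynomial (Fin n) ℂ) : dzbar v (dz v (holo p)) = 0 := by
  induction p using MvPolynomial.induction_on with
  | C c => simp [holo]
  | add p q hp hq => simp [hp, hq]
  | mul_X p j hp =>
    have h := dzbar_holo v p
    simp [holo, Derivation.leibniz] at hp h ⊢
    simp [hp, h]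

theorem dz_dzbar_conjStar_holo (p : MvPolynomial (Fin n) ℂ) :
    dz v (dzbar v (conjStar n (holo p))) = 0 := by
  rw [← conjStar_dz, ← conjStar_dzbar, dzbar_dz_holo, map_zero]

/-- Only four terms of the Leibniz expansion survive, since ∂̄_v kills p and ∂_v kills p*. -/
theorem dz_dzbar_hermSq_mul (p : MvPolynomial (Fin n) ℂ) (g : CPoly n) :
    dz v (dzbar v ((hermSq p : CPoly n) * g)) =
      dz v (holo p) * conjStar n (dz v (holo p)) * g
        + holo p * conjStar n (dz v (holo p)) * dz v g
        + dz v (holo p) * conjStar n (holo p) * dzbar v g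
        + holo p * conjStar n (holo p) * dz v (dzbar v g) := by
  simp only [hermSq, Derivation.leibniz, map_add, smul_eq_mul, dzbar_holo, dz_conjStar_holo,
    dz_dzbar_conjStar_holo, conjStar_dz, map_zero]
  ring

@[simp] theorem cval_add (f g : CPoly n) : cval a (f + g) = cval a f + cval a g := map_add _ _ _

@[simp] theorem cval_mul (f g : CPoly n) : cval a (f * g) = cval a f * cval a g := map_mul _ _ _

@[simp] theorem cval_C (c : ℂ) : cval a (C c : CPoly n) = c := eval_C _

@[simp] theorem cval_X_inl (j : Fin n) : cval a (X (Sum.inl j)) = a j := eval_X _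

@[simp] theorem cval_X_inr (j : Fin n) :
    cval a (X (Sum.inr j)) = starRingEnd ℂ (a j) := eval_X _

@[simp] theorem cval_one : cval a (1 : CPoly n) = 1 := map_one _

@[simp] theorem cval_zero : cval a (0 : CPoly n) = 0 := map_zero _

/-- The functional `h ↦ (∂_v ∂̄_v h)(a) + A h(a)`: the Levi form of `h` at `a` in direction `v`,
shifted by `A` times the value. -/
noncomputable def leviShift (A : ℝ) : RealPoly n →ₗ[ℝ] ℝ where
  toFun h := (cval a (dz v (dzbar v (h : CPoly n)))).re + A * val a h
  map_add' f g := by simp [val]; ring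
  map_smul' r f := by
    have h : ((r • f : RealPoly n) : CPoly n) = (r : ℂ) • (f : CPoly n) := rfl
    have hs (c : ℂ) (q : CPoly n) : cval a (c • q) = c * cval a q := by
      rw [MvPolynomial.smul_eq_C_mul, cval_mul, cval_C]
    simp only [val, h, Derivation.map_smul, hs, Complex.re_ofReal_mul, RingHom.id_apply,
      smul_eq_mul]
    ring

theorem leviShift_apply (A : ℝ) (h : RealPoly n) :
    leviShift v a A h = (cval a (dz v (dzbar v (h : CPoly n)))).re + A * val a h := rfl

/-- The bound on A is the determinant condition |c|² ≤ r (k + A r); the proof completes the square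
in ‖y‖. It is applied with r, c, k the value, ∂̄_v and ∂_v ∂̄_v of g at a, and x, y those of p and
∂_v p. -/
theorem hermitian_quadratic_nonneg {r k A : ℝ} (c x y : ℂ) (hr : 0 < r)
    (hA : (‖c‖ ^ 2 / r - k) / r ≤ A) :
    0 ≤ ‖y‖ ^ 2 * r + 2 * (x * starRingEnd ℂ y * starRingEnd ℂ c).re
      + ‖x‖ ^ 2 * k + A * (‖x‖ ^ 2 * r) := by
  have h1 : -(‖x‖ * ‖y‖ * ‖c‖) ≤ (x * starRingEnd ℂ y * starRingEnd ℂ c).re := by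
    have := (abs_le.mp (Complex.abs_re_le_norm (x * starRingEnd ℂ y * starRingEnd ℂ c))).1
    simpa using this
  have h2 : ‖c‖ ^ 2 / r ≤ k + A * r := by
    rw [div_le_iff₀ hr] at hA
    linarith
  have h3 : ‖x‖ ^ 2 * (‖c‖ ^ 2 / r) ≤ ‖x‖ ^ 2 * (k + A * r) := by gcongr
  have h4 : 0 ≤ (‖y‖ * r - ‖x‖ * ‖c‖) ^ 2 / r := by positivity
  have h5 : (‖y‖ * r - ‖x‖ * ‖c‖) ^ 2 / r
      = ‖y‖ ^ 2 * r - 2 * (‖x‖ * ‖y‖ * ‖c‖) + ‖x‖ ^ 2 * (‖c‖ ^ 2 / r) := by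
    field_simp
    ring
  linarith

theorem leviShift_hermSq_mul (A : ℝ) (p : MvPolynomial (Fin n) ℂ) (g : RealPoly n) :
    leviShift v a A (hermSq p * g) =
      ‖cval a (dz v (holo p))‖ ^ 2 * val a g
        + 2 * (cval a (holo p) * starRingEnd ℂ (cval a (dz v (holo p)))
          * starRingEnd ℂ (cval a (dzbar v (g : CPoly n)))).re
        + ‖cval a (holo p)‖ ^ 2 * (cval a (dz v (dzbar v (g : CPoly n)))).re
        + A * (‖cval a (holo p)‖ ^ 2 * val a g) := by
  have hg : cval a (dz v (g : CPoly n)) = starRingEnd ℂ (cval a (dzbar v (g : CPoly n))) := by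
    rw [← cval_conjStar, conjStar_dzbar, show conjStar n (g : CPoly n) = g from g.2]
  have hv : val a (hermSq p * g) = ‖cval a (holo p)‖ ^ 2 * val a g := by
    have : cval a ((hermSq p * g : RealPoly n) : CPoly n)
        = ((‖cval a (holo p)‖ ^ 2 * val a g : ℝ) : ℂ) := by
      push_cast
      rw [val_eq, ← Complex.mul_conj', ← cval_conjStar]
      simp [hermSq]
    rw [val, this, Complex.ofReal_re]
  rw [leviShift_apply, hv]
  rw [show ((hermSq p * g : RealPoly n) : CPoly n) = (hermSq p : CPoly n) * g from rfl,
    dz_dzbar_hermSq_mul]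
  simp only [cval_add, cval_mul, cval_conjStar, hg, ← val_eq, Complex.mul_conj', Complex.add_re]
  rw [← Complex.ofReal_pow, ← Complex.ofReal_pow, ← Complex.ofReal_mul, Complex.ofReal_re,
    Complex.re_ofReal_mul]
  -- The two cross terms are complex conjugates because g is real, so their real parts agree.
  have : (cval a (dz v (holo p)) * starRingEnd ℂ (cval a (holo p))
      * cval a (dzbar v (g : CPoly n))).re = (cval a (holo p)
      * starRingEnd ℂ (cval a (dz v (holo p)))
      * starRingEnd ℂ (cval a (dzbar v (g : CPoly n)))).re := by
    rw [← Complex.conj_re]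
    simp only [map_mul, Complex.conj_conj]
    congr 1
    ring
  rw [this]
  ring

/-- For large `A`, the functional `leviShift` is nonnegative on `Σ_h g` as soon as `g(a) > 0`, or
`g` vanishes at `a` together with its derivatives `∂̄_v g` and `∂_v ∂̄_v g`. -/
theorem exists_leviShift_nonneg (g : RealPoly n)
    (hg : 0 < val a g ∨ (val a g = 0 ∧ cval a (dzbar v (g : CPoly n)) = 0 ∧
      cval a (dz v (dzbar v (g : CPoly n))) = 0)) :
    ∃ A₀ : ℝ, ∀ A ≥ A₀, ∀ σ ∈ SigmaH n, 0 ≤ leviShift v a A (σ * g) := by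
  obtain ⟨A₀, hA₀⟩ : ∃ A₀ : ℝ, ∀ A ≥ A₀, ∀ p, 0 ≤ leviShift v a A (hermSq p * g) := by
    rcases hg with h | ⟨h0, h1, h2⟩
    · refine ⟨(‖cval a (dzbar v (g : CPoly n))‖ ^ 2 / val a g
        - (cval a (dz v (dzbar v (g : CPoly n)))).re) / val a g, fun A hA p => ?_⟩
      rw [leviShift_hermSq_mul]
      exact hermitian_quadratic_nonneg _ _ _ h hA
    · refine ⟨0, fun A _ p => ?_⟩
      rw [leviShift_hermSq_mul, h0, h1, h2]
      simp
  refine ⟨A₀, fun A hA σ hσ => ?_⟩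
  change σ ∈ hermCone n at hσ
  unfold hermCone at hσ
  induction hσ using Submodule.span_induction with
  | zero => simp
  | add x y _ _ hx hy => rw [add_mul, map_add]; exact add_nonneg hx hy
  | smul c x _ hx =>
    rw [smul_mul_assoc]
    change 0 ≤ leviShift v a A ((c : ℝ) • (x * g))
    rw [map_smul]
    exact mul_nonneg c.2 hx
  | mem x hx =>
    obtain ⟨p, rfl⟩ := hx
    exact hA₀ A hA p

theorem exists_leviShift_nonneg_of_fg (M : HermitianModule n) (S : Finset (RealPoly n))
    (hS : Submodule.span (SigmaH n) (S : Set (RealPoly n)) = M.toSubmodule)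
    (hg : ∀ g ∈ S, 0 < val a g ∨ (val a g = 0 ∧ cval a (dzbar v (g : CPoly n)) = 0 ∧
      cval a (dz v (dzbar v (g : CPoly n))) = 0)) :
    ∃ A : ℝ, ∀ f ∈ M.toSubmodule, 0 ≤ leviShift v a A f := by
  choose! B hB using fun g (h : g ∈ S) => exists_leviShift_nonneg v a g (hg g h)
  obtain ⟨A, hA⟩ := (S.image B).bddAbove
  refine ⟨A, fun f hf => ?_⟩
  rw [← hS] at hf
  -- `leviShift` is only ℝ-linear, so the factor σ is carried through the induction to absorb
  -- scalars from Σ_h.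
  suffices h : ∀ σ ∈ SigmaH n, 0 ≤ leviShift v a A (σ * f) by
    simpa using h 1 (SigmaH n).one_mem
  induction hf using Submodule.span_induction with
  | zero => simp
  | add x y _ _ hx hy =>
    intro σ hσ
    rw [mul_add, map_add]
    exact add_nonneg (hx σ hσ) (hy σ hσ)
  | smul c x _ hx =>
    intro σ hσ
    change 0 ≤ leviShift v a A (σ * ((c : RealPoly n) * x))
    rw [← mul_assoc]
    exact hx _ (mul_mem hσ c.2)
  | mem x hx =>
    exact hB x hx A (hA (Finset.mem_coe.mpr (Finset.mem_image_of_mem B hx)))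

/-- The squared distance `|z - a|²` as a real polynomial. -/
noncomputable def distSq : RealPoly n := ∑ j, hermSq (X j - C (a j))

theorem coe_distSq : ((distSq a : RealPoly n) : CPoly n) =
    ∑ j, (X (Sum.inl j) - C (a j)) * (X (Sum.inr j) - C (starRingEnd ℂ (a j))) := by
  simp [distSq, hermSq, holo, conjStar_X, conjStar_C]

theorem cval_sum {ι : Type*} (s : Finset ι) (f : ι → CPoly n) :
    cval a (∑ i ∈ s, f i) = ∑ i ∈ s, cval a (f i) := map_sum _ _ _

@[simp] theorem cval_sub (f g : CPoly n) : cval a (f - g) = cval a f - cval a g := map_sub _ _ _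

theorem cval_distSq : cval a (distSq a : CPoly n) = 0 := by
  simp [coe_distSq, cval_sum]

theorem cval_dzbar_distSq : cval a (dzbar v (distSq a : CPoly n)) = 0 := by
  simp [coe_distSq, cval_sum, Derivation.leibniz]

theorem cval_dz_dzbar_distSq :
    cval a (dz v (dzbar v (distSq a : CPoly n))) = ((∑ j, ‖v j‖ ^ 2 : ℝ) : ℂ) := by
  simp [coe_distSq, cval_sum, Derivation.leibniz, Complex.conj_mul']

theorem exists_pos_leviShift_neg (hv : v ≠ 0) (A : ℝ) :
    ∃ f : RealPoly n, (∀ b, 0 < val b f) ∧ leviShift v a A f < 0 := by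
  have hs : 0 < ∑ j, ‖v j‖ ^ 2 := by
    obtain ⟨j, hj⟩ := Function.ne_iff.mp hv
    exact Finset.sum_pos' (fun _ _ => by positivity)
      ⟨j, Finset.mem_univ _, by have : 0 < ‖v j‖ := norm_pos_iff.mpr hj
                                positivity⟩
  -- For w = N|z - a|² - 1, the functional takes the value 2A - 2N|v|² on w² + 1: at a, w = -1 and
  -- its first derivatives vanish.
  obtain ⟨N, hN⟩ := exists_gt (A / ∑ j, ‖v j‖ ^ 2)
  rw [div_lt_iff₀ hs] at hN
  set w : RealPoly n := N • distSq a - 1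
  have hwc : (w : CPoly n) = C (N : ℂ) * (distSq a : CPoly n) - C 1 := by
    rw [C_1, ← MvPolynomial.smul_eq_C_mul]; rfl
  have hfc : ((w * w + 1 : RealPoly n) : CPoly n) = (w : CPoly n) * (w : CPoly n) + C 1 := by
    rw [C_1]; rfl
  have hval (b : Fin n → ℂ) : val b (w * w + 1) = val b w * val b w + 1 := by
    rw [val, hfc, cval_add, cval_mul, ← val_eq, cval_C, ← Complex.ofReal_mul]
    simp
  refine ⟨w * w + 1, fun b => ?_, ?_⟩
  · rw [hval]
    nlinarith [mul_self_nonneg (val b w)]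
  · have hwa : cval a (w : CPoly n) = -1 := by
      rw [hwc]; simp [cval_distSq]
    have h1 : cval a (dzbar v (w : CPoly n)) = 0 := by
      rw [hwc]; simp [cval_dzbar_distSq, Derivation.leibniz]
    have h2 : cval a (dz v (dzbar v (w : CPoly n))) = ((N * ∑ j, ‖v j‖ ^ 2 : ℝ) : ℂ) := by
      rw [hwc]; simp [cval_dz_dzbar_distSq, Derivation.leibniz]
    have h3 : cval a (dz v (dzbar v ((w * w + 1 : RealPoly n) : CPoly n)))
        = ((-2 * (N * ∑ j, ‖v j‖ ^ 2) : ℝ) : ℂ) := by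
      rw [hfc]
      simp only [Derivation.leibniz, map_add, smul_eq_mul, dzbar_C, map_zero, cval_add, cval_mul,
        h1, h2, hwa, cval_zero]
      push_cast
      ring
    rw [leviShift_apply, h3, hval, val, hwa, Complex.ofReal_re]
    norm_num
    linarith

end Algebra

/-! ### Differentiation along the analytic disc and choice of the point. -/

section Disc

variable {n : ℕ}

/-- The Wirtinger form of the derivative of a polynomial along a holomorphic curve. -/
theorem hasFDerivAt_cval {φ : ℂ → Fin n → ℂ} {t : ℂ} {v : Fin n → ℂ} (hφ : HasDerivAt φ v t)
    (f : CPoly n) :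
    HasFDerivAt (𝕜 := ℝ) (fun t => cval (φ t) f)
      (cval (φ t) (dz v f) • (ContinuousLinearMap.id ℝ ℂ)
        + cval (φ t) (dzbar v f) • (Complex.conjCLE : ℂ →L[ℝ] ℂ)) t := by
  induction f using MvPolynomial.induction_on with
  | C c =>
    simp only [cval_C, dz_C, dzbar_C, cval_zero]
    refine (hasFDerivAt_const (𝕜 := ℝ) c t).congr_fderiv ?_
    ext s; simp
  | add p q hp hq =>
    simp only [cval_add, map_add]
    refine (hp.add hq).congr_fderiv ?_
    ext s; simp; ring
  | mul_X p s hp =>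
    have hj (j : Fin n) : HasFDerivAt (𝕜 := ℝ) (fun t => φ t j)
        (v j • ContinuousLinearMap.id ℝ ℂ) t := by
      refine ((hasDerivAt_pi.mp hφ j).hasFDerivAt.restrictScalars ℝ).congr_fderiv ?_
      ext s; simp [mul_comm]
    rcases s with j | j
    · simp only [cval_mul, cval_X_inl]
      refine (hp.mul (hj j)).congr_fderiv ?_
      ext s; simp [Derivation.leibniz]; ring
    · simp only [cval_mul, cval_X_inr]
      have hc : HasFDerivAt (𝕜 := ℝ) (fun t => starRingEnd ℂ (φ t j))
          ((Complex.conjCLE : ℂ →L[ℝ] ℂ).comp (v j • ContinuousLinearMap.id ℝ ℂ)) t :=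
        ((Complex.conjCLE : ℂ →L[ℝ] ℂ).hasFDerivAt).comp t (hj j)
      refine (hp.mul hc).congr_fderiv ?_
      ext s; simp [Derivation.leibniz]; ring

/-- The identity and conjugation are linearly independent over ℂ, as evaluation at 1 and i shows. -/
theorem wirtinger_eq_zero {A B : ℂ}
    (h : A • (ContinuousLinearMap.id ℝ ℂ) + B • (Complex.conjCLE : ℂ →L[ℝ] ℂ) = 0) :
    A = 0 ∧ B = 0 := by
  have h1 : A + B = 0 := by simpa using DFunLike.congr_fun h 1
  have h2 : A * Complex.I + B * -Complex.I = 0 := by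
    simpa using DFunLike.congr_fun h Complex.I
  have h3 : A - B = 0 := by
    have : (A - B) * Complex.I = 0 := by linear_combination h2
    simpa using this
  constructor
  · linear_combination (h1 + h3) / 2
  · linear_combination (h1 - h3) / 2

/-- Separates the direction from the polynomial, so that v may vary along the curve when
differentiating. -/
theorem dzbar_eq_sum (v : Fin n → ℂ) (f : CPoly n) :
    dzbar v f = ∑ j, C (starRingEnd ℂ (v j)) * pderiv (Sum.inr j) f := by
  induction f using MvPolynomial.induction_on with
  | C c => simp
  | add p q hp hq => simp [hp, hq, mul_add, Finset.sum_add_distrib]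
  | mul_X p s hp =>
    rcases s with j | j
    · simp [hp, Derivation.leibniz, pderiv_X, Finset.mul_sum, mul_left_comm]
    · simp [hp, Derivation.leibniz, pderiv_X, Finset.mul_sum, mul_left_comm, mul_add,
        Finset.sum_add_distrib, Pi.single_apply, mul_comm]

/-- Differentiating g ∘ φ = 0 gives the first claim on all of U; differentiating that identity again
gives the second. -/
theorem vanish_along {U : Set ℂ} (hU : IsOpen U) {φ : ℂ → Fin n → ℂ}
    (hφ : DifferentiableOn ℂ φ U) (g : CPoly n) (hg : ∀ t ∈ U, cval (φ t) g = 0) {t : ℂ}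
    (ht : t ∈ U) :
    cval (φ t) (dzbar (deriv φ t) g) = 0 ∧
      cval (φ t) (dz (deriv φ t) (dzbar (deriv φ t) g)) = 0 := by
  have hd (s : ℂ) (hs : s ∈ U) : HasDerivAt φ (deriv φ s) s :=
    (hφ.differentiableAt (hU.mem_nhds hs)).hasDerivAt
  have h1 (s : ℂ) (hs : s ∈ U) : cval (φ s) (dzbar (deriv φ s) g) = 0 := by
    have h0 : HasFDerivAt (𝕜 := ℝ) (fun t => cval (φ t) g) (0 : ℂ →L[ℝ] ℂ) s :=
      (hasFDerivAt_const (0 : ℂ) s).congr_of_eventuallyEq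
        (eventually_of_mem (hU.mem_nhds hs) hg)
    exact (wirtinger_eq_zero ((hasFDerivAt_cval (hd s hs) g).unique h0)).2
  refine ⟨h1 t ht, ?_⟩
  have hd2 : HasDerivAt (deriv φ) (deriv (deriv φ) t) t :=
    ((hφ.deriv hU).differentiableAt (hU.mem_nhds ht)).hasDerivAt
  have hc (j : Fin n) : HasFDerivAt (𝕜 := ℝ) (fun s => starRingEnd ℂ (deriv φ s j))
      (starRingEnd ℂ (deriv (deriv φ) t j) • (Complex.conjCLE : ℂ →L[ℝ] ℂ)) t := by
    have := ((Complex.conjCLE : ℂ →L[ℝ] ℂ).hasFDerivAt).comp t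
      ((hasDerivAt_pi.mp hd2 j).hasFDerivAt.restrictScalars ℝ)
    refine this.congr_fderiv ?_
    ext s; simp [mul_comm]
  have hsum := HasFDerivAt.fun_sum (u := Finset.univ) fun j _ =>
    (hc j).mul (hasFDerivAt_cval (hd t ht) (pderiv (Sum.inr j) g))
  have h0 : HasFDerivAt (𝕜 := ℝ) (fun s => ∑ j, starRingEnd ℂ (deriv φ s j) *
      cval (φ s) (pderiv (Sum.inr j) g)) (0 : ℂ →L[ℝ] ℂ) t := by
    refine (hasFDerivAt_const (0 : ℂ) t).congr_of_eventuallyEq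
      (eventually_of_mem (hU.mem_nhds ht) fun s hs => ?_)
    have := h1 s hs
    rw [dzbar_eq_sum, cval_sum] at this
    simpa using this
  have heq := hsum.unique h0
  set v := deriv φ t
  -- The moving direction conj φ' is antiholomorphic, so φ'' enters only the conjugate-linear part
  -- B; the complex-linear part is exactly the Levi form.
  refine (wirtinger_eq_zero (B := ∑ j, (starRingEnd ℂ (v j) *
    cval (φ t) (dzbar v (pderiv (Sum.inr j) g)) +
    cval (φ t) (pderiv (Sum.inr j) g) * starRingEnd ℂ (deriv (deriv φ) t j))) ?_).1
  rw [← heq, dzbar_eq_sum, map_sum, cval_sum]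
  ext s
  simp [Derivation.leibniz, Finset.sum_mul, ← Finset.sum_add_distrib]
  refine Finset.sum_congr rfl fun j _ => ?_
  ring

/-- Continuity suffices: a nonnegative function not identically zero on V is positive on a smaller
open set, and the alternatives already obtained survive shrinking. -/
theorem exists_open_sign {U : Set ℂ} (hU : IsOpen U) (hne : U.Nonempty) {φ : ℂ → Fin n → ℂ}
    (hφ : DifferentiableOn ℂ φ U) (S : Finset (RealPoly n))
    (hS : ∀ g ∈ S, ∀ t ∈ U, 0 ≤ val (φ t) g) :
    ∃ V ⊆ U, IsOpen V ∧ V.Nonempty ∧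
      ∀ g ∈ S, (∀ t ∈ V, 0 < val (φ t) g) ∨ ∀ t ∈ V, val (φ t) g = 0 := by
  classical
  induction S using Finset.induction_on with
  | empty => exact ⟨U, subset_rfl, hU, hne, by simp⟩
  | insert g S _ ih =>
    obtain ⟨V, hVU, hV, hVne, hVS⟩ := ih fun g hg => hS g (Finset.mem_insert_of_mem hg)
    by_cases h : ∀ t ∈ V, val (φ t) g = 0
    · refine ⟨V, hVU, hV, hVne, fun k hk => ?_⟩
      rcases Finset.mem_insert.mp hk with rfl | hk
      · exact Or.inr h
      · exact hVS k hk
    · push Not at h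
      obtain ⟨t, ht, htg⟩ := h
      have hcont : ContinuousOn (fun t => val (φ t) g) V := fun s hs =>
        (Complex.continuous_re.continuousAt.comp (hasFDerivAt_cval
          (hφ.differentiableAt (hU.mem_nhds (hVU hs))).hasDerivAt
          (g : CPoly n)).continuousAt).continuousWithinAt
      refine ⟨V ∩ (fun t => val (φ t) g) ⁻¹' Set.Ioi 0, fun s hs => hVU hs.1,
        hcont.isOpen_inter_preimage hV isOpen_Ioi,
        ⟨t, ht, lt_of_le_of_ne (hS g (Finset.mem_insert_self _ _) t (hVU ht)) htg.symm⟩,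
        fun k hk => ?_⟩
      rcases Finset.mem_insert.mp hk with rfl | hk
      · exact Or.inl fun s hs => hs.2
      · exact (hVS k hk).imp (fun h s hs => h s hs.1) (fun h s hs => h s hs.1)

theorem exists_open_deriv_ne_zero {φ : ℂ → Fin n → ℂ}
    (hφ : DifferentiableOn ℂ φ (Metric.ball 0 1))
    (hne : ∃ z ∈ Metric.ball (0 : ℂ) 1, ∃ w ∈ Metric.ball (0 : ℂ) 1, φ z ≠ φ w) :
    ∃ U ⊆ Metric.ball (0 : ℂ) 1, IsOpen U ∧ U.Nonempty ∧ ∀ t ∈ U, deriv φ t ≠ 0 := by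
  refine ⟨Metric.ball 0 1 ∩ deriv φ ⁻¹' {0}ᶜ, Set.inter_subset_left,
    (hφ.deriv Metric.isOpen_ball).continuousOn.isOpen_inter_preimage Metric.isOpen_ball
      isOpen_compl_singleton, ?_, fun t ht => ht.2⟩
  by_contra h
  obtain ⟨z, hz, w, hw, hzw⟩ := hne
  refine hzw (Metric.isOpen_ball.is_const_of_deriv_eq_zero
    (convex_ball (0 : ℂ) 1).isPreconnected hφ (fun t ht => ?_) hz hw)
  by_contra h'
  exact h ⟨t, ht, h'⟩

end Disc

end HermPoly

theorem mainTheorem7 (n : ℕ) (M : HermPoly.HermitianModule n) (hM : M.FinitelyGenerated)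
    (hdisc : ∃ D : Set (Fin n → ℂ), HermPoly.IsAnalyticDisc D ∧ D ⊆ M.posSet) :
    ¬ M.QuillenProperty := by
  obtain ⟨_, ⟨φ, hφ, hne, rfl⟩, hD⟩ := hdisc
  obtain ⟨S, hS⟩ := hM
  obtain ⟨U, hUB, hU, hUne, hU0⟩ := HermPoly.exists_open_deriv_ne_zero hφ hne
  obtain ⟨V, hVU, hV, ⟨t, ht⟩, hVS⟩ := HermPoly.exists_open_sign hU hUne (hφ.mono hUB) S
    fun g hg s hs => hD ⟨s, hUB hs, rfl⟩ g (hS ▸ Submodule.subset_span hg)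
  obtain ⟨A, hA⟩ := HermPoly.exists_leviShift_nonneg_of_fg (deriv φ t) (φ t) M S hS
    fun g hg => (hVS g hg).imp (fun h => h t ht) fun h =>
      ⟨h t ht, HermPoly.vanish_along hV (hφ.mono (hVU.trans hUB)) g
        (fun s hs => by rw [← HermPoly.val_eq, h s hs, Complex.ofReal_zero]) ht⟩
  obtain ⟨f, hf, hneg⟩ := HermPoly.exists_pos_leviShift_neg (deriv φ t) (φ t) (hU0 t (hVU ht)) A
  exact fun hQ => absurd (hA f (hQ f fun a _ => hf a)) (not_le.mpr hneg)
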